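/- For an integer $m\ge 0$ let $\mathbf B_m$ be the set of monotone maps $\rho:(0,\infty)\to(0,\infty)$ such that $\sum_{n\ge 2}\rho(c/n^2)(\ln n)^m/n$ converges for every $c>0$. Let $\mathbf{P_B}_m$ be the set of functions $f:\mathbb R\to\mathbb C$ of period $1$ for which there is $\rho\in\mathbf B_m$ such that $(x,y)\mapsto (f(x)-f(y))/\rho(|x-y|)$ is continuous and bounded on $\{(x,y)\in\mathbb R^2: x\ne y\}$. Theorem. Let $L,M,N$ be integers $>1$ with $M\ne N$, and let $f\in\mathbf{P_B}_{L-1}$. For $w>0$ put $$f(w,L-1)=(-\ln w)^{L-1}\,w^{-1}\,f(\log_{M/N}w).$$ Then $$(L-1)!\,\bigl(\ln(M/N)\bigr)^L\int_0^1 f(t)\,dt=\sum_{l=0}^{L-1}\binom{L-1}{l}(-M)^lN^{L-1-l}\,\bigl[S_l-T_l\bigr],$$ where $$S_l=\sum_{k=1}^{M-1}\sum_{n\ge1}\Bigl(f\bigl(M^lN^{L-1-l}(Mn-k),L-1\bigr)-f\bigl(M^{l+1}N^{L-1-l}n,L-1\bigr)\Bigr),$$ $$T_l=\sum_{k=1}^{N-1}\sum_{n\ge1}\Bigl(f\bigl(M^lN^{L-1-l}(Nn-k),L-1\bigr)-f\bigl(M^lN^{L-l}n,L-1\bigr)\Bigr),$$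 and, for every $0\le l\le L-1$, each of the double series $S_l$ and $T_l$ (the terms being the differences in parentheses, indexed by $(n,k)$) converges absolutely. -/

import Mathlib

/-- The class `B_m`: monotone maps `ρ` of `(0, ∞)` into itself for which the series
`∑_{n ≥ 2} ρ(c / n²) (log n)^m / n` converges for every `c > 0`.
Only the values of `ρ` on `(0, ∞)` matter. -/
structure ClassB (m : ℕ) (ρ : ℝ → ℝ) : Prop where
  pos : ∀ x : ℝ, 0 < x → 0 < ρ x
  mono : MonotoneOn ρ (Set.Ioi 0) ∨ AntitoneOn ρ (Set.Ioi 0)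
  summable : ∀ c : ℝ, 0 < c →
    Summable fun n : ℕ => ρ (c / ((n : ℝ) + 2) ^ 2) * Real.log ((n : ℝ) + 2) ^ m / ((n : ℝ) + 2)

/-- The class `P_{B,m}`: functions of period one on the real line such that, for some `ρ` in `B_m`,
the quotient `(f x - f y) / ρ |x - y|` is a continuous and bounded function of `(x, y)`, `x ≠ y`. -/
def ClassPB (m : ℕ) (f : ℝ → ℂ) : Prop :=
  Function.Periodic f 1 ∧ ∃ ρ : ℝ → ℝ, ClassB m ρ ∧
    ContinuousOn (fun p : ℝ × ℝ => (f p.1 - f p.2) / (ρ |p.1 - p.2| : ℂ)) {p | p.1 ≠ p.2} ∧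
    ∃ C : ℝ, ∀ x y : ℝ, x ≠ y → ‖(f x - f y) / (ρ |x - y| : ℂ)‖ ≤ C

/-- `f(w, m) = (-log w)^m w⁻¹ f(log_b w)`, where `b` is the base of the logarithm. -/
noncomputable def weighted (f : ℝ → ℂ) (b : ℝ) (m : ℕ) (w : ℝ) : ℂ :=
  (((-Real.log w) ^ m * w⁻¹ : ℝ) : ℂ) * f (Real.logb b w)

/-- The term `f(a(Kn - k), m) - f(aKn, m)` of a double series over `(n, k)`. -/
noncomputable def seriesTerm (f : ℝ → ℂ) (b : ℝ) (m : ℕ) (a K k n : ℕ) : ℂ :=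
  weighted f b m ((a : ℝ) * ((K : ℝ) * n - k)) - weighted f b m ((a : ℝ) * ((K : ℝ) * n))

open Filter Topology

/-! Write `m = L - 1`, `b = M/N`, `w` for the weighted function and `W` for its primitive. Each
scale `a > 0` has an Euler-type constant `Γ(a) = lim (a ∑_{n ≤ X} w(an) - W(aX))`, which exists
because the oscillation of `w` over unit steps is summable; this is where `B_m` enters
(`ClassPB.summable_oscillation`). Grouping integers into blocks of `K` gives `a S = Γ(a) - Γ(aM)`
and `a T = Γ(a) - Γ(aN)`. For `a = M^l N^(m-l)` the difference is `Γ(aN) - Γ(aM)`, with `aN =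
N^(m+1) b^l` and `aM = N^(m+1) b^(l+1)`. By Pascal's rule the right-hand side is, up to sign, an
`(m+1)`-st finite difference in `l` of `Γ(N^(m+1) b^l)`. Multiplying the argument by `b` shifts
`log_b` by one and leaves the value of `f` unchanged. So `a w(ax)` is polynomial of degree at most
`m` in `l` and is annihilated, while the `(m+1)`-st difference of `W` is a multiple of `m! ∫ f`. -/

/-! ### Moduli of continuity in `B_m` -/

/-- Otherwise the series defining `B_m` would dominate a multiple of the harmonic series. -/
theorem ClassB.exists_lt {m : ℕ} {ρ : ℝ → ℝ} (hρ : ClassB m ρ) {δ : ℝ} (hδ : 0 < δ) :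
    ∃ n : ℕ, ρ (1 / ((n : ℝ) + 2) ^ 2) < δ := by
  by_contra! h
  have hlog : 0 < Real.log 2 := Real.log_pos one_lt_two
  have hs : Summable fun n : ℕ => (δ * Real.log 2 ^ m) * (1 / ((n + 2 : ℕ) : ℝ)) := by
    refine Summable.of_nonneg_of_le (fun n => by positivity) (fun n => ?_)
      (hρ.summable 1 one_pos)
    have h2 : Real.log 2 ^ m ≤ Real.log ((n : ℝ) + 2) ^ m :=
      pow_le_pow_left₀ hlog.le (Real.log_le_log two_pos (by linarith [n.cast_nonneg (α := ℝ)])) m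
    have h3 := mul_le_mul (h n) h2 (by positivity) (hδ.le.trans (h n))
    push_cast
    rw [mul_one_div]
    gcongr
  rw [summable_mul_left_iff (by positivity)] at hs
  exact Real.not_summable_one_div_natCast ((summable_nat_add_iff 2).1 hs)

theorem ClassB.monotoneOn {m : ℕ} {ρ : ℝ → ℝ} (hρ : ClassB m ρ) :
    MonotoneOn ρ (Set.Ioi 0) := by
  refine hρ.mono.resolve_right fun h => ?_
  obtain ⟨n, hn⟩ := hρ.exists_lt (hρ.pos 1 one_pos)
  refine hn.not_ge (h (Set.mem_Ioi.2 (by positivity)) (Set.mem_Ioi.2 one_pos) ?_)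
  rw [div_le_one (by positivity)]
  nlinarith [n.cast_nonneg (α := ℝ)]

theorem ClassB.exists_forall_lt {m : ℕ} {ρ : ℝ → ℝ} (hρ : ClassB m ρ) {δ : ℝ} (hδ : 0 < δ) :
    ∃ ε > 0, ∀ x, 0 < x → x < ε → ρ x < δ := by
  obtain ⟨n, hn⟩ := hρ.exists_lt hδ
  refine ⟨1 / ((n : ℝ) + 2) ^ 2, by positivity, fun x hx hxε => ?_⟩
  exact (hρ.monotoneOn hx (Set.mem_Ioi.2 (by positivity)) hxε.le).trans_lt hn

/-- A modulus of continuity of a function of class `P_{B,m}`. -/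
theorem ClassPB.exists_modulus {m : ℕ} {f : ℝ → ℂ} (hf : ClassPB m f) :
    ∃ (ρ : ℝ → ℝ) (C : ℝ), ClassB m ρ ∧ 0 < C ∧
      ∀ x y : ℝ, x ≠ y → ‖f x - f y‖ ≤ C * ρ |x - y| := by
  obtain ⟨-, ρ, hρ, -, C, hC⟩ := hf
  refine ⟨ρ, max C 1, hρ, by positivity, fun x y hxy => ?_⟩
  have hpos := hρ.pos |x - y| (abs_pos.2 (sub_ne_zero.2 hxy))
  have h := hC x y hxy
  rw [norm_div, Complex.norm_real, Real.norm_of_nonneg hpos.le, div_le_iff₀ hpos] at h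
  exact h.trans (mul_le_mul_of_nonneg_right (le_max_left _ _) hpos.le)

theorem ClassPB.continuous {m : ℕ} {f : ℝ → ℂ} (hf : ClassPB m f) : Continuous f := by
  obtain ⟨ρ, C, hρ, hC, h⟩ := hf.exists_modulus
  refine Metric.continuous_iff.2 fun x ε hε => ?_
  obtain ⟨η, hη, hlt⟩ := hρ.exists_forall_lt (div_pos hε hC)
  refine ⟨η, hη, fun y hy => ?_⟩
  rcases eq_or_ne y x with rfl | hne
  · simpa using hε
  rw [dist_eq_norm]
  rw [Real.dist_eq] at hy
  have := hlt _ (abs_pos.2 (sub_ne_zero.2 hne)) hy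
  rw [lt_div_iff₀' hC] at this
  exact (h y x hne).trans_lt this

theorem ClassPB.exists_norm_le {m : ℕ} {f : ℝ → ℂ} (hf : ClassPB m f) :
    ∃ B > 0, ∀ x, ‖f x‖ ≤ B := by
  obtain ⟨B, hB⟩ := isCompact_Icc.exists_bound_of_continuousOn (s := Set.Icc (0 : ℝ) 1)
    hf.continuous.continuousOn
  refine ⟨max B 1, by positivity, fun x => ?_⟩
  obtain ⟨y, hy, hxy⟩ := hf.1.exists_mem_Ico₀ one_pos x
  rw [hxy]
  exact (hB y (Set.Ico_subset_Icc_self hy)).trans (le_max_left _ _)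

/-- Exactly `2q + 1` integers have integer square root `q`. -/
theorem summable_comp_sqrt {G : ℕ → ℝ} (hG : ∀ q, 0 ≤ G q)
    (hs : Summable fun q : ℕ => (2 * (q : ℝ) + 1) * G q) :
    Summable fun n : ℕ => G n.sqrt := by
  have hsig : Summable fun p : (Σ q : ℕ, Fin (2 * q + 1)) => G p.1 := by
    refine (summable_sigma_of_nonneg fun p => hG p.1).2 ⟨fun q => Summable.of_finite, ?_⟩
    simpa using hs
  let e : ℕ → Σ q : ℕ, Fin (2 * q + 1) := fun n =>
    ⟨n.sqrt, ⟨n - n.sqrt * n.sqrt, by have := n.sqrt_le_add; omega⟩⟩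
  have he : Function.Injective e := by
    intro n k h
    have h1 : n.sqrt = k.sqrt := congrArg Sigma.fst h
    have h2 : n - n.sqrt * n.sqrt = k - k.sqrt * k.sqrt :=
      congrArg (fun p : (Σ q : ℕ, Fin (2 * q + 1)) => (p.2 : ℕ)) h
    have h3 := n.sqrt_le
    have h4 := k.sqrt_le
    rw [h1] at h2 h3
    omega
  exact hsig.comp_injective he

/-- Condensation along squares trades `c / n²` for `c / n`, the order of the variation of `log` over
a bounded interval starting at `n`. -/
theorem ClassB.summable_log_mul_div {m : ℕ} {ρ : ℝ → ℝ} (hρ : ClassB m ρ) {c : ℝ} (hc : 0 < c) :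
    Summable fun n : ℕ => Real.log ((n : ℝ) + 1) ^ m * (ρ (c / n) / n) := by
  let G : ℕ → ℝ := fun q => (2 * Real.log ((q : ℝ) + 1)) ^ m * (ρ (c / (q : ℝ) ^ 2) / (q : ℝ) ^ 2)
  have hlog : ∀ q : ℕ, 0 ≤ Real.log ((q : ℝ) + 1) := fun q =>
    Real.log_nonneg (by linarith [q.cast_nonneg (α := ℝ)])
  have hG : ∀ q, 0 ≤ G q := by
    intro q
    rcases q.eq_zero_or_pos with rfl | hq
    · simp [G]
    · have hq' : (0 : ℝ) < q := by exact_mod_cast hq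
      have := hρ.pos (c / (q : ℝ) ^ 2) (by positivity)
      have := hlog q
      positivity
  have hGs : Summable fun q : ℕ => (2 * (q : ℝ) + 1) * G q := by
    rw [← summable_nat_add_iff 2]
    refine Summable.of_nonneg_of_le (fun q => mul_nonneg (by positivity) (hG _)) (fun q => ?_)
      ((hρ.summable c hc).mul_left (3 * 4 ^ m))
    have hx : (2 : ℝ) ≤ (q : ℝ) + 2 := by linarith [q.cast_nonneg (α := ℝ)]
    simp only [G]
    push_cast
    set x : ℝ := (q : ℝ) + 2
    have hx0 : 0 < x := by linarith
    have hρx := hρ.pos (c / x ^ 2) (by positivity)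
    have h1 : 2 * Real.log (x + 1) ≤ 4 * Real.log x := by
      have : Real.log (x + 1) ≤ Real.log (x ^ 2) := Real.log_le_log (by linarith) (by nlinarith)
      rw [Real.log_pow] at this
      push_cast at this
      linarith
    have h0 : 0 ≤ 2 * Real.log (x + 1) := mul_nonneg two_pos.le (Real.log_nonneg (by linarith))
    have h2 := pow_le_pow_left₀ h0 h1 m
    have h3 : (2 * x + 1) / x ^ 2 ≤ 3 / x := by
      rw [div_le_div_iff₀ (by positivity) hx0]
      nlinarith
    calc (2 * x + 1) * ((2 * Real.log (x + 1)) ^ m * (ρ (c / x ^ 2) / x ^ 2))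
        = (2 * Real.log (x + 1)) ^ m * ρ (c / x ^ 2) * ((2 * x + 1) / x ^ 2) := by ring
      _ ≤ (4 * Real.log x) ^ m * ρ (c / x ^ 2) * (3 / x) := by
          have : 0 ≤ 4 * Real.log x := h0.trans h1
          gcongr
      _ = 3 * 4 ^ m * (ρ (c / x ^ 2) * Real.log x ^ m / x) := by rw [mul_pow]; ring
  refine Summable.of_nonneg_of_le (fun n => ?_) (fun n => ?_) (summable_comp_sqrt hG hGs)
  · rcases n.eq_zero_or_pos with rfl | hn
    · simp
    · have hn' : (0 : ℝ) < n := by exact_mod_cast hn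
      have := hρ.pos (c / n) (by positivity)
      have := hlog n
      positivity
  · rcases n.eq_zero_or_pos with rfl | hn
    · simpa using hG _
    · have hn' : (0 : ℝ) < n := by exact_mod_cast hn
      have hq : (0 : ℝ) < n.sqrt := by exact_mod_cast Nat.sqrt_pos.2 hn
      have hqn : (n.sqrt : ℝ) ^ 2 ≤ n := by exact_mod_cast n.sqrt_le'
      have hnq : (n : ℝ) + 1 ≤ ((n.sqrt : ℝ) + 1) ^ 2 := by exact_mod_cast n.lt_succ_sqrt'
      have h1 : Real.log ((n : ℝ) + 1) ≤ 2 * Real.log ((n.sqrt : ℝ) + 1) := by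
        have := Real.log_le_log (by linarith) hnq
        rwa [Real.log_pow] at this
      have h2 : ρ (c / n) ≤ ρ (c / (n.sqrt : ℝ) ^ 2) :=
        hρ.monotoneOn (Set.mem_Ioi.2 (by positivity)) (Set.mem_Ioi.2 (by positivity))
          (by gcongr)
      have := hlog n
      have := h1.trans' this
      have := hρ.pos (c / n) (by positivity)
      have := hρ.pos (c / (n.sqrt : ℝ) ^ 2) (by positivity)
      simp only [G]
      gcongr

/-! ### Summable oscillation of the weighted function -/

theorem summable_log_pow_div_sq (m : ℕ) :
    Summable fun n : ℕ => Real.log ((n : ℝ) + 1) ^ m * (1 / (n : ℝ) ^ 2) := by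
  have hO := ((isLittleO_log_rpow_rpow_atTop (m : ℝ) (one_half_pos (α := ℝ))).comp_tendsto
    (tendsto_natCast_atTop_atTop.comp (tendsto_add_atTop_nat 1))).bound one_pos
  refine summable_of_isBigO_nat
    (Real.summable_one_div_nat_rpow.2 (show (1 : ℝ) < 3 / 2 by norm_num))
    (Asymptotics.IsBigO.of_bound ((2 : ℝ) ^ (1 / 2 : ℝ)) ?_)
  filter_upwards [hO, eventually_gt_atTop 0] with n hn hn0
  have hn1 : (1 : ℝ) ≤ n := by exact_mod_cast hn0
  have hn' : (0 : ℝ) < n := by linarith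
  simp only [Function.comp_apply, Real.rpow_natCast, one_mul, Nat.cast_add, Nat.cast_one] at hn
  rw [norm_mul, Real.norm_of_nonneg (by positivity : 0 ≤ 1 / (n : ℝ) ^ 2),
    Real.norm_of_nonneg (by positivity : 0 ≤ 1 / (n : ℝ) ^ (3 / 2 : ℝ))]
  rw [Real.norm_of_nonneg (by positivity : 0 ≤ ((n : ℝ) + 1) ^ (1 / 2 : ℝ))] at hn
  have h1 : ((n : ℝ) + 1) ^ (1 / 2 : ℝ) ≤ (2 * n) ^ (1 / 2 : ℝ) :=
    Real.rpow_le_rpow (by positivity) (by linarith) (by norm_num)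
  have h2 : (n : ℝ) ^ (1 / 2 : ℝ) * (1 / (n : ℝ) ^ 2) = 1 / (n : ℝ) ^ (3 / 2 : ℝ) := by
    rw [mul_one_div, div_eq_div_iff (by positivity) (by positivity), one_mul,
      ← Real.rpow_add hn', ← Real.rpow_natCast]
    norm_num
  rw [← h2, ← mul_assoc, ← Real.mul_rpow two_pos.le hn'.le]
  exact mul_le_mul_of_nonneg_right (hn.trans h1) (by positivity)

theorem abs_log_mul_le {a R : ℝ} (ha : 0 < a) (hR : 0 < R) :
    ∃ κ > 0, ∀ n : ℕ, 1 ≤ n → 1 ≤ κ * Real.log ((n : ℝ) + 1) ∧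
      ∀ x : ℝ, (n : ℝ) ≤ x → x ≤ n + R → |Real.log (a * x)| ≤ κ * Real.log ((n : ℝ) + 1) := by
  have h2 : 0 < Real.log 2 := Real.log_pos one_lt_two
  have hR' : 0 ≤ Real.log (R + 1) := Real.log_nonneg (by linarith)
  -- Constants are absorbed into `log (n + 1)` through `log 2 ≤ log (n + 1)`.
  refine ⟨(1 + |Real.log a| + Real.log (R + 1)) / Real.log 2 + 1, by positivity,
    fun n hn => ?_⟩
  have hn1 : (1 : ℝ) ≤ n := by exact_mod_cast hn
  have hl : Real.log 2 ≤ Real.log ((n : ℝ) + 1) := Real.log_le_log two_pos (by linarith)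
  have key : 1 + |Real.log a| + Real.log (R + 1) + Real.log ((n : ℝ) + 1) ≤
      ((1 + |Real.log a| + Real.log (R + 1)) / Real.log 2 + 1) * Real.log ((n : ℝ) + 1) := by
    rw [add_one_mul, div_mul_eq_mul_div]
    gcongr
    rw [le_div_iff₀ h2]
    gcongr
  refine ⟨le_trans ?_ key, fun x hnx hxn => le_trans ?_ key⟩
  · linarith [abs_nonneg (Real.log a)]
  · have hx : 1 ≤ x := hn1.trans hnx
    have hx' : Real.log x ≤ Real.log ((n : ℝ) + 1) + Real.log (R + 1) := by
      rw [← Real.log_mul (by positivity) (by positivity)]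
      exact Real.log_le_log (by linarith) (by nlinarith)
    rw [Real.log_mul ha.ne' (by linarith)]
    have := abs_add_le (Real.log a) (Real.log x)
    rw [abs_of_nonneg (Real.log_nonneg hx)] at this
    linarith

theorem abs_log_sub_log_le {x y n R : ℝ} (hn : 0 < n) (hx : n ≤ x) (hy : n ≤ y)
    (hxR : x ≤ n + R) (hyR : y ≤ n + R) : |Real.log x - Real.log y| ≤ R / n := by
  have aux : ∀ u v : ℝ, n ≤ u → u ≤ n + R → n ≤ v → v ≤ n + R →
      Real.log u - Real.log v ≤ R / n := by
    intro u v hu huR hv hvR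
    have hu0 : 0 < u := hn.trans_le hu
    have hv0 : 0 < v := hn.trans_le hv
    rw [← Real.log_div hu0.ne' hv0.ne']
    refine (Real.log_le_sub_one_of_pos (div_pos hu0 hv0)).trans ?_
    rw [div_sub_one hv0.ne', div_le_div_iff₀ hv0 hn]
    nlinarith
  rw [abs_le]
  exact ⟨by linarith [aux y x hy hyR hx hxR], aux x y hx hxR hy hyR⟩

theorem abs_log_pow_div_sub_le (m : ℕ) {a R P n x y : ℝ} (ha : 0 < a) (hP : 1 ≤ P) (hn : 0 < n)
    (hx : n ≤ x) (hy : n ≤ y) (hxR : x ≤ n + R) (hyR : y ≤ n + R)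
    (hxP : |Real.log (a * x)| ≤ P) (hyP : |Real.log (a * y)| ≤ P) :
    |(-Real.log (a * x)) ^ m * (a * x)⁻¹ - (-Real.log (a * y)) ^ m * (a * y)⁻¹| ≤
      (m + 1) * P ^ m * R / a * (1 / n ^ 2) := by
  have hx0 : 0 < x := hn.trans_le hx
  have hy0 : 0 < y := hn.trans_le hy
  have hR : 0 ≤ R := by linarith
  have hpow : |(-Real.log (a * x)) ^ m - (-Real.log (a * y)) ^ m| ≤ R / n * m * P ^ m := by
    refine (abs_pow_sub_pow_le _ _ _).trans ?_
    have h1 : |-Real.log (a * x) - -Real.log (a * y)| ≤ R / n := by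
      rw [Real.log_mul ha.ne' hx0.ne', Real.log_mul ha.ne' hy0.ne']
      convert abs_log_sub_log_le hn hy hx hyR hxR using 2
      ring
    -- `P ≥ 1` permits raising the exponent `m - 1` to `m`, also when `m = 0` and the subtraction
    -- truncates.
    have h2 : max |-Real.log (a * x)| |-Real.log (a * y)| ^ (m - 1) ≤ P ^ m := by
      refine (pow_le_pow_left₀ (by positivity) (max_le ?_ ?_) _).trans
        (pow_le_pow_right₀ hP (Nat.sub_le m 1)) <;> rwa [abs_neg]
    gcongr
  have hinv : |(a * x)⁻¹ - (a * y)⁻¹| ≤ R / a * (1 / n ^ 2) := by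
    rw [inv_sub_inv (by positivity) (by positivity), abs_div,
      abs_of_pos (by positivity : 0 < a * x * (a * y)), ← mul_sub, abs_mul, abs_of_pos ha,
      div_mul_div_comm, div_le_div_iff₀ (by positivity) (by positivity)]
    have h1 : |y - x| ≤ R := abs_le.2 ⟨by linarith, by linarith⟩
    have h2 : n ^ 2 ≤ x * y := by nlinarith
    calc a * |y - x| * (a * n ^ 2) ≤ a * R * (a * (x * y)) := by gcongr
      _ = R * 1 * (a * x * (a * y)) := by ring
  have hyPm : |(-Real.log (a * y)) ^ m| ≤ P ^ m := by
    rw [abs_pow, abs_neg]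
    exact pow_le_pow_left₀ (abs_nonneg _) hyP m
  have hxi : |(a * x)⁻¹| ≤ (a * n)⁻¹ := by
    rw [abs_of_pos (by positivity)]
    gcongr
  calc _ = |((-Real.log (a * x)) ^ m - (-Real.log (a * y)) ^ m) * (a * x)⁻¹ +
        (-Real.log (a * y)) ^ m * ((a * x)⁻¹ - (a * y)⁻¹)| := by congr 1; ring
    _ ≤ R / n * m * P ^ m * (a * n)⁻¹ + P ^ m * (R / a * (1 / n ^ 2)) := by
        refine (abs_add_le _ _).trans ?_
        rw [abs_mul, abs_mul]
        gcongr
    _ = (m + 1) * P ^ m * R / a * (1 / n ^ 2) := by field_simp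

/-- The oscillation of `weighted f b m` over the intervals `[a n, a (n + R)]` is summable. -/
theorem ClassPB.summable_oscillation {m : ℕ} {f : ℝ → ℂ} (hf : ClassPB m f) {b : ℝ}
    (hb : Real.log b ≠ 0) {a R : ℝ} (ha : 0 < a) (hR : 0 < R) :
    ∃ D : ℕ → ℝ, Summable D ∧ ∀ n : ℕ, 1 ≤ n → ∀ x y : ℝ, (n : ℝ) ≤ x → x ≤ n + R →
      (n : ℝ) ≤ y → y ≤ n + R → ‖weighted f b m (a * x) - weighted f b m (a * y)‖ ≤ D n := by
  obtain ⟨ρ, C, hρ, hC, hmod⟩ := hf.exists_modulus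
  obtain ⟨B, hB, hfB⟩ := hf.exists_norm_le
  obtain ⟨κ, hκ, hlog⟩ := abs_log_mul_le ha hR
  set c : ℝ := R / |Real.log b| with hc_def
  have hb' : 0 < |Real.log b| := abs_pos.2 hb
  have hc : 0 < c := by positivity
  -- The first summand of the bound comes from the variation of the weight, the second from that of
  -- `f`.
  refine ⟨_, ((summable_log_pow_div_sq m).mul_left ((m + 1) * κ ^ m * R / a * B)).add
    ((hρ.summable_log_mul_div hc).mul_left (κ ^ m / a * C)), fun n hn x y hx hxR hy hyR => ?_⟩
  obtain ⟨hP, hPx⟩ := hlog n hn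
  set P := κ * Real.log ((n : ℝ) + 1) with hP_def
  have hn0 : (0 : ℝ) < n := by exact_mod_cast hn
  have hx0 : 0 < x := hn0.trans_le hx
  have hy0 : 0 < y := hn0.trans_le hy
  have hφ := abs_log_pow_div_sub_le m ha hP hn0 hx hy hxR hyR (hPx x hx hxR) (hPx y hy hyR)
  have hφy : |(-Real.log (a * y)) ^ m * (a * y)⁻¹| ≤ P ^ m * (a * n)⁻¹ := by
    rw [abs_mul, abs_pow, abs_neg, abs_of_pos (by positivity : 0 < (a * y)⁻¹)]
    have := hPx y hy hyR
    gcongr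
  have hfd : ‖f (Real.logb b (a * x)) - f (Real.logb b (a * y))‖ ≤ C * ρ (c / n) := by
    by_cases hxy : Real.logb b (a * x) = Real.logb b (a * y)
    · rw [hxy, sub_self, norm_zero]
      exact (mul_pos hC (hρ.pos _ (by positivity))).le
    · refine (hmod _ _ hxy).trans ?_
      gcongr
      refine hρ.monotoneOn (abs_pos.2 (sub_ne_zero.2 hxy)) (Set.mem_Ioi.2 (by positivity)) ?_
      rw [Real.logb, Real.logb, ← sub_div, abs_div, Real.log_mul ha.ne' hx0.ne',
        Real.log_mul ha.ne' hy0.ne', add_sub_add_left_eq_sub, hc_def, div_right_comm]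
      gcongr
      exact abs_log_sub_log_le hn0 hx hy hxR hyR
  set φx : ℝ := (-Real.log (a * x)) ^ m * (a * x)⁻¹ with hφx_def
  set φy : ℝ := (-Real.log (a * y)) ^ m * (a * y)⁻¹ with hφy_def
  calc ‖weighted f b m (a * x) - weighted f b m (a * y)‖
      = ‖((φx - φy : ℝ) : ℂ) * f (Real.logb b (a * x)) +
          (φy : ℂ) * (f (Real.logb b (a * x)) - f (Real.logb b (a * y)))‖ := by
        rw [weighted, weighted, ← hφx_def, ← hφy_def]
        push_cast
        congr 1
        ring
    _ ≤ (m + 1) * P ^ m * R / a * (1 / (n : ℝ) ^ 2) * B + P ^ m * (a * n)⁻¹ * (C * ρ (c / n)) := by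
        refine (norm_add_le _ _).trans ?_
        rw [norm_mul, norm_mul, Complex.norm_real, Complex.norm_real, Real.norm_eq_abs,
          Real.norm_eq_abs]
        have := hfB (Real.logb b (a * x))
        have h0 : 0 ≤ P := by linarith
        gcongr
    _ = _ := by
        rw [hP_def, mul_pow]
        field_simp

/-- The primitive of `u ↦ u ^ m * f u` vanishing at `0`. -/
noncomputable def powPrimitive (f : ℝ → ℂ) (m : ℕ) (y : ℝ) : ℂ :=
  ∫ u in (0 : ℝ)..y, (u : ℂ) ^ m * f u

/-- A primitive of `weighted f b m` on `(0, ∞)`. -/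
noncomputable def weightedPrimitive (f : ℝ → ℂ) (b : ℝ) (m : ℕ) (x : ℝ) : ℂ :=
  (-(Real.log b : ℂ)) ^ m * (Real.log b : ℂ) * powPrimitive f m (Real.logb b x)

/-! ### Primitives and Euler-type constants -/

theorem hasDerivAt_powPrimitive {f : ℝ → ℂ} (hf : Continuous f) (m : ℕ) (y : ℝ) :
    HasDerivAt (powPrimitive f m) ((y : ℂ) ^ m * f y) y := by
  have hc : Continuous fun u : ℝ => (u : ℂ) ^ m * f u := by fun_prop
  exact intervalIntegral.integral_hasDerivAt_right (hc.intervalIntegrable _ _)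
    (hc.stronglyMeasurableAtFilter _ _) hc.continuousAt

theorem hasDerivAt_weightedPrimitive {f : ℝ → ℂ} (hf : Continuous f) {b : ℝ}
    (hb : Real.log b ≠ 0) (m : ℕ) {x : ℝ} (hx : 0 < x) :
    HasDerivAt (weightedPrimitive f b m) (weighted f b m x) x := by
  have hlog : HasDerivAt (Real.logb b) (x⁻¹ / Real.log b) x :=
    (Real.hasDerivAt_log hx.ne').div_const _
  have h := ((hasDerivAt_powPrimitive hf m (Real.logb b x)).scomp x hlog).const_mul
    ((-(Real.log b : ℂ)) ^ m * (Real.log b : ℂ))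
  refine h.congr_deriv ?_
  have hb' : (Real.log b : ℂ) ≠ 0 := by exact_mod_cast hb
  have hx' : Real.log x = Real.log b * Real.logb b x := by rw [Real.logb]; field_simp
  rw [weighted, hx', Complex.real_smul]
  push_cast
  rw [← neg_mul, mul_pow]
  field_simp

/-- Consecutive terms differ by the error of a one-point quadrature of `w` on a unit step, which the
summable oscillation bounds. -/
theorem ClassPB.exists_tendsto_sum_sub_primitive {m : ℕ} {f : ℝ → ℂ} (hf : ClassPB m f) {b : ℝ}
    (hb : Real.log b ≠ 0) {a : ℝ} (ha : 0 < a) :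
    ∃ γ : ℂ, Tendsto (fun X : ℕ => (a : ℂ) * ∑ n ∈ Finset.range X,
      weighted f b m (a * ((n : ℝ) + 1)) - weightedPrimitive f b m (a * X)) atTop (𝓝 γ) := by
  obtain ⟨D, hD, hosc⟩ := hf.summable_oscillation hb ha one_pos
  set u : ℕ → ℂ := fun X => (a : ℂ) * ∑ n ∈ Finset.range X,
      weighted f b m (a * ((n : ℝ) + 1)) - weightedPrimitive f b m (a * X) with hu
  -- The shift avoids `X = 0`, where the oscillation bound is not available.
  have hC : CauchySeq fun X : ℕ => u (X + 1) := by
    refine cauchySeq_of_dist_le_of_summable (fun X => a * D (X + 1)) (fun X => ?_)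
      (((summable_nat_add_iff 1).2 hD).mul_left a)
    rw [dist_comm, dist_eq_norm]
    have hY1 : 1 ≤ X + 1 := X.succ_pos
    change ‖u (X + 1 + 1) - u (X + 1)‖ ≤ a * D (X + 1)
    generalize X + 1 = Y at hY1 ⊢
    have hY : (0 : ℝ) < Y := by exact_mod_cast hY1
    have hd : ∀ x ∈ Set.Icc (Y : ℝ) (Y + 1), HasDerivWithinAt
        (fun x : ℝ => (x : ℂ) * (a * weighted f b m (a * ((Y : ℝ) + 1))) -
          weightedPrimitive f b m (a * x))
        (a * weighted f b m (a * ((Y : ℝ) + 1)) - a * weighted f b m (a * x))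
        (Set.Icc (Y : ℝ) (Y + 1)) x := by
      intro x hx
      have hx0 : 0 < x := hY.trans_le hx.1
      have h1 := (Complex.ofRealCLM.hasDerivAt (x := x)).mul_const
        ((a : ℂ) * weighted f b m (a * ((Y : ℝ) + 1)))
      have h2 := (hasDerivAt_weightedPrimitive hf.continuous hb m (mul_pos ha hx0)).scomp x
        ((hasDerivAt_id x).const_mul a)
      refine ((h1.sub h2).congr_deriv ?_).hasDerivWithinAt
      simp
    have hbound := (convex_Icc (Y : ℝ) (Y + 1)).norm_image_sub_le_of_norm_hasDerivWithin_le hd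
      (C := a * D Y) (fun x hx => by
        rw [← mul_sub, norm_mul, Complex.norm_real, Real.norm_of_nonneg ha.le]
        gcongr
        exact hosc Y hY1 _ _ (by linarith) le_rfl hx.1 hx.2)
      (Set.left_mem_Icc.2 (by linarith)) (Set.right_mem_Icc.2 (by linarith))
    convert hbound using 1
    · congr 1
      simp only [hu, Finset.sum_range_succ]
      push_cast
      ring
    · simp
  obtain ⟨γ, hγ⟩ := cauchySeq_tendsto_of_complete hC
  exact ⟨γ, (tendsto_add_atTop_iff_nat 1).1 hγ⟩

/-! ### The double series as differences of constants -/

theorem ClassPB.summable_norm_seriesTerm {m : ℕ} {f : ℝ → ℂ} (hf : ClassPB m f) {b : ℝ}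
    (hb : Real.log b ≠ 0) {a K k : ℕ} (ha : 0 < a) (hk : k ∈ Finset.Icc 1 (K - 1)) :
    Summable fun n : ℕ => ‖seriesTerm f b m a K k (n + 1)‖ := by
  rw [Finset.mem_Icc] at hk
  have hK : 0 < K := by omega
  have hkK : (k : ℝ) + 1 ≤ K := by exact_mod_cast (by omega : k + 1 ≤ K)
  obtain ⟨D, hD, hosc⟩ := hf.summable_oscillation hb (a := a) (R := K)
    (by exact_mod_cast ha) (by exact_mod_cast hK)
  have hinj : Function.Injective fun n : ℕ => K * n + 1 := fun x y h => by
    simpa [hK.ne'] using h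
  refine Summable.of_nonneg_of_le (fun _ => norm_nonneg _) (fun n => ?_)
    (hD.comp_injective hinj)
  -- Both `K(n + 1) - k` and `K(n + 1)` lie in `[Kn + 1, Kn + 1 + K]`.
  refine hosc (K * n + 1) (by omega) _ _ ?_ ?_ ?_ ?_ <;> push_cast <;>
    nlinarith [k.cast_nonneg (α := ℝ)]

/-- Each multiple of `K` is subtracted `K - 1` times; adding it once to complete its block makes the
coefficient `K`. -/
theorem sum_range_sum_Icc_seriesTerm (f : ℝ → ℂ) (b : ℝ) (m a : ℕ) {K : ℕ} (hK : 0 < K) (X : ℕ) :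
    ∑ n ∈ Finset.range X, ∑ k ∈ Finset.Icc 1 (K - 1), seriesTerm f b m a K k (n + 1) =
      ∑ j ∈ Finset.range (K * X), weighted f b m (a * ((j : ℝ) + 1)) -
        K * ∑ n ∈ Finset.range X, weighted f b m (a * K * ((n : ℝ) + 1)) := by
  induction X with
  | zero => simp
  | succ X ih =>
    have hblock : ∑ j ∈ Finset.range K, weighted f b m (a * (((K * X + j : ℕ) : ℝ) + 1)) =
        ∑ k ∈ Finset.Icc 1 (K - 1), weighted f b m (a * ((K : ℝ) * ((X + 1 : ℕ) : ℝ) - k)) +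
          weighted f b m (a * K * ((X : ℝ) + 1)) := by
      obtain ⟨K, rfl⟩ := Nat.exists_eq_succ_of_ne_zero hK.ne'
      rw [Finset.sum_range_succ, Nat.succ_eq_add_one, Nat.add_sub_cancel,
        ← Finset.sum_range_reflect, ← Finset.Ico_add_one_right_eq_Icc,
        Finset.sum_Ico_eq_sum_range]
      congr 1
      · refine Finset.sum_congr (by simp) fun j hj => ?_
        have : j < K := by simpa using hj
        congr 2
        rw [Nat.sub_sub, add_comm 1 j]
        push_cast [Nat.cast_sub this]
        ring
      · congr 1
        push_cast
        ring
    rw [Finset.sum_range_succ, ih, Nat.mul_succ, Finset.sum_range_add, hblock,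
      Finset.sum_range_succ]
    simp only [seriesTerm, Finset.sum_sub_distrib, Finset.sum_const, Nat.card_Icc,
      Nat.add_sub_cancel, nsmul_eq_mul]
    rw [Nat.cast_sub hK]
    push_cast
    rw [mul_assoc (a : ℝ) (K : ℝ)]
    ring

/-- With upper limits `KX` at scale `a` and `X` at scale `aK`, both primitives are evaluated at
`aKX` and cancel. -/
theorem ClassPB.mul_sum_tsum_seriesTerm {m : ℕ} {f : ℝ → ℂ} (hf : ClassPB m f) {b : ℝ}
    (hb : Real.log b ≠ 0) {a K : ℕ} (ha : 0 < a) (hK : 0 < K) {γ γ' : ℂ}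
    (hγ : Tendsto (fun X : ℕ => ((a : ℝ) : ℂ) * ∑ n ∈ Finset.range X,
      weighted f b m (a * ((n : ℝ) + 1)) - weightedPrimitive f b m (a * X)) atTop (𝓝 γ))
    (hγ' : Tendsto (fun X : ℕ => ((a * K : ℝ) : ℂ) * ∑ n ∈ Finset.range X,
      weighted f b m (a * K * ((n : ℝ) + 1)) - weightedPrimitive f b m (a * K * X))
      atTop (𝓝 γ')) :
    (a : ℂ) * ∑ k ∈ Finset.Icc 1 (K - 1), ∑' n : ℕ, seriesTerm f b m a K k (n + 1) = γ - γ' := by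
  have hlim := (tendsto_finsetSum (Finset.Icc 1 (K - 1)) fun k hk =>
    (hf.summable_norm_seriesTerm hb ha hk).of_norm.hasSum.tendsto_sum_nat).const_mul (a : ℂ)
  have hKX : Tendsto (fun X : ℕ => K * X) atTop atTop :=
    tendsto_id.const_mul_atTop' hK
  refine tendsto_nhds_unique hlim (((hγ.comp hKX).sub hγ').congr fun X => ?_)
  rw [Finset.sum_comm, sum_range_sum_Icc_seriesTerm f b m a hK X]
  simp only [Function.comp_apply]
  push_cast
  rw [mul_assoc (a : ℝ) (K : ℝ) (X : ℝ)]
  ring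

/-! ### Finite differences in `l` -/

/-- One difference produces an integral over a period. By periodicity the other `m` act only on `u ^
m`, giving `m!`. -/
theorem sum_neg_one_pow_choose_mul_powPrimitive {f : ℝ → ℂ} (hf : Continuous f)
    (hper : Function.Periodic f 1) (m : ℕ) (s : ℝ) :
    ∑ l ∈ Finset.range (m + 2), (-1 : ℂ) ^ l * (m + 1).choose l * powPrimitive f m (s + l) =
      (-1) ^ (m + 1) * (m.factorial * ∫ t in (0 : ℝ)..1, f t) := by
  have hdiff : ∀ l : ℕ, fwdDiff 1 (powPrimitive f m) (s + l) =
      ∫ u in s..(s + 1), ((u : ℂ) + l) ^ m * f u := by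
    intro l
    have hc : Continuous fun u : ℝ => (u : ℂ) ^ m * f u := by fun_prop
    rw [fwdDiff, powPrimitive, powPrimitive, intervalIntegral.integral_interval_sub_left
      (hc.intervalIntegrable _ _) (hc.intervalIntegrable _ _), add_right_comm,
      ← intervalIntegral.integral_comp_add_right]
    refine intervalIntegral.integral_congr fun u _ => ?_
    have : f (u + l) = f u := by simpa using hper.nat_mul l u
    simp [this]
  have hmain : (fwdDiff 1)^[m + 1] (powPrimitive f m) s =
      m.factorial * ∫ t in (0 : ℝ)..1, f t := by
    rw [Function.iterate_succ_apply, fwdDiff_iter_eq_sum_shift]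
    simp only [nsmul_eq_mul, mul_one, hdiff, zsmul_eq_mul]
    simp only [← intervalIntegral.integral_const_mul]
    rw [← intervalIntegral.integral_finsetSum fun i _ =>
      (by fun_prop : Continuous _).intervalIntegrable _ _]
    have hpoly : ∀ u : ℝ, ∑ k ∈ Finset.range (m + 1),
        (((-1 : ℤ) ^ (m - k) * m.choose k : ℤ) : ℂ) * (((u : ℂ) + k) ^ m * f u) = m.factorial * f u := by
      intro u
      have h := congrFun (fwdDiff_iter_eq_factorial (R := ℂ) (n := m)) (u : ℂ)
      rw [fwdDiff_iter_eq_sum_shift] at h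
      simp only [nsmul_eq_mul, mul_one, zsmul_eq_mul] at h
      simp only [← mul_assoc, ← Finset.sum_mul, h]
      simp
    simp only [hpoly]
    rw [intervalIntegral.integral_const_mul, hper.intervalIntegral_add_eq s 0, zero_add,
      intervalIntegral.integral_const_mul]
  rw [← hmain, fwdDiff_iter_eq_sum_shift, Finset.mul_sum]
  refine Finset.sum_congr rfl fun l hl => ?_
  have hl' : l ≤ m + 1 := by rw [Finset.mem_range] at hl; omega
  have hsign : (-1 : ℂ) ^ (m + 1) * (-1) ^ (m + 1 - l) = (-1) ^ l := by
    rw [← pow_add, show m + 1 + (m + 1 - l) = l + 2 * (m + 1 - l) by omega, pow_add, pow_mul]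
    simp
  simp only [nsmul_eq_mul, mul_one, zsmul_eq_mul]
  push_cast
  rw [← hsign]
  ring

theorem logb_mul_pow_mul {b A x : ℝ} (hb0 : 0 < b) (hb : Real.log b ≠ 0) (hA : 0 < A)
    (hx : 0 < x) (l : ℕ) : Real.logb b (A * b ^ l * x) = Real.logb b (A * x) + l := by
  rw [mul_right_comm, Real.logb, Real.logb, Real.log_mul (by positivity) (by positivity),
    Real.log_pow]
  field_simp

theorem sum_choose_mul_weightedPrimitive {f : ℝ → ℂ} (hf : Continuous f)
    (hper : Function.Periodic f 1) (m : ℕ) {b A x : ℝ} (hb0 : 0 < b) (hb : Real.log b ≠ 0)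
    (hA : 0 < A) (hx : 0 < x) :
    ∑ l ∈ Finset.range (m + 2), (-1 : ℂ) ^ l * (m + 1).choose l *
        weightedPrimitive f b m (A * b ^ l * x) =
      -(m.factorial * (Real.log b : ℂ) ^ (m + 1) * ∫ t in (0 : ℝ)..1, f t) := by
  have h := sum_neg_one_pow_choose_mul_powPrimitive hf hper m (Real.logb b (A * x))
  simp only [weightedPrimitive, logb_mul_pow_mul hb0 hb hA hx]
  rw [Finset.sum_congr rfl fun l _ => mul_left_comm _ _ _, ← Finset.mul_sum, h, neg_pow (Real.log b : ℂ)]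
  have h1 : ((-1 : ℂ) ^ m) * (-1) ^ m = 1 := by rw [← mul_pow]; simp
  linear_combination (-(Real.log b : ℂ) ^ (m + 1) * m.factorial * ∫ t in (0 : ℝ)..1, f t) * h1

theorem sum_choose_mul_weighted {f : ℝ → ℂ} (hper : Function.Periodic f 1) (m : ℕ) {b A x : ℝ}
    (hb0 : 0 < b) (hb : Real.log b ≠ 0) (hA : 0 < A) (hx : 0 < x) :
    ∑ l ∈ Finset.range (m + 2), (-1 : ℂ) ^ l * (m + 1).choose l *
        (((A * b ^ l : ℝ) : ℂ) * weighted f b m (A * b ^ l * x)) = 0 := by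
  set s := Real.logb b (A * x) with hs
  have hterm : ∀ l : ℕ, ((A * b ^ l : ℝ) : ℂ) * weighted f b m (A * b ^ l * x) =
      ((-Real.log b) ^ m * x⁻¹ : ℝ) * f s * ((s : ℂ) + l) ^ m := by
    intro l
    have hlogb := logb_mul_pow_mul hb0 hb hA hx l
    have hlog : Real.log (A * b ^ l * x) = Real.log b * (s + l) := by
      rw [← hlogb, Real.logb, mul_div_cancel₀ _ hb]
    have hfs : f (s + l) = f s := by simpa using hper.nat_mul l s
    have hα : 0 < A * b ^ l := by positivity
    rw [weighted, hlogb, hfs, hlog]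
    generalize A * b ^ l = α at hα
    have : α * ((-(Real.log b * (s + l))) ^ m * (α * x)⁻¹) =
        (-Real.log b) ^ m * x⁻¹ * (s + l) ^ m := by
      rw [← neg_mul, mul_pow]
      field_simp
    rw [← mul_assoc, ← Complex.ofReal_mul, this]
    push_cast
    ring
  have hpoly := congrFun (fwdDiff_iter_pow_eq_zero_of_lt (R := ℂ) m.lt_succ_self) (s : ℂ)
  rw [fwdDiff_iter_eq_sum_shift] at hpoly
  simp only [nsmul_eq_mul, mul_one, zsmul_eq_mul, Pi.zero_apply] at hpoly
  have hsum : ∑ l ∈ Finset.range (m + 2), (-1 : ℂ) ^ l * (m + 1).choose l * ((s : ℂ) + l) ^ m =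
      (-1) ^ (m + 1) * 0 := by
    rw [← hpoly, Finset.mul_sum]
    refine Finset.sum_congr rfl fun l hl => ?_
    have hl' : l ≤ m + 1 := by rw [Finset.mem_range] at hl; omega
    have hsign : (-1 : ℂ) ^ (m + 1) * (-1) ^ (m + 1 - l) = (-1) ^ l := by
      rw [← pow_add, show m + 1 + (m + 1 - l) = l + 2 * (m + 1 - l) by omega, pow_add, pow_mul]
      simp
    push_cast
    rw [← hsign]
    ring
  simp only [hterm]
  rw [Finset.sum_congr rfl fun l _ => mul_left_comm _ _ _, ← Finset.mul_sum, hsum, mul_zero, mul_zero]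

theorem sum_choose_mul_limit {f : ℝ → ℂ} (hf : Continuous f) (hper : Function.Periodic f 1)
    (m : ℕ) {b A : ℝ} (hb0 : 0 < b) (hb : Real.log b ≠ 0) (hA : 0 < A) {γ : ℕ → ℂ}
    (hγ : ∀ l, Tendsto (fun X : ℕ => ((A * b ^ l : ℝ) : ℂ) * ∑ n ∈ Finset.range X,
      weighted f b m (A * b ^ l * ((n : ℝ) + 1)) - weightedPrimitive f b m (A * b ^ l * X))
      atTop (𝓝 (γ l))) :
    ∑ l ∈ Finset.range (m + 2), (-1 : ℂ) ^ l * (m + 1).choose l * γ l =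
      m.factorial * (Real.log b : ℂ) ^ (m + 1) * ∫ t in (0 : ℝ)..1, f t := by
  refine tendsto_nhds_unique (tendsto_finsetSum _ fun l _ => (hγ l).const_mul _)
    (tendsto_const_nhds.congr' ?_)
  filter_upwards [eventually_gt_atTop 0] with X hX
  simp only [mul_sub, Finset.sum_sub_distrib]
  rw [sum_choose_mul_weightedPrimitive hf hper m hb0 hb hA (by exact_mod_cast hX), sub_neg_eq_add]
  simp only [Finset.mul_sum]
  rw [Finset.sum_comm, Finset.sum_eq_zero fun n _ =>
    sum_choose_mul_weighted hper m hb0 hb hA n.cast_add_one_pos, zero_add]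

/-- Summation by parts with Pascal's rule. -/
theorem sum_choose_mul_sub_succ (m : ℕ) (γ : ℕ → ℂ) :
    ∑ l ∈ Finset.range (m + 1), (-1 : ℂ) ^ l * m.choose l * (γ l - γ (l + 1)) =
      ∑ l ∈ Finset.range (m + 2), (-1 : ℂ) ^ l * (m + 1).choose l * γ l := by
  have h : ∑ l ∈ Finset.range (m + 2), (-1 : ℂ) ^ l * m.choose l * γ l =
      ∑ l ∈ Finset.range (m + 1), (-1 : ℂ) ^ l * m.choose l * γ l := by
    simp [Finset.sum_range_succ _ (m + 1)]
  rw [Finset.sum_range_succ'] at h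
  have h' : ∀ l ∈ Finset.range (m + 1),
      (-1 : ℂ) ^ (l + 1) * (m + 1).choose (l + 1) * γ (l + 1) =
        (-1 : ℂ) ^ (l + 1) * m.choose (l + 1) * γ (l + 1) -
          (-1 : ℂ) ^ l * m.choose l * γ (l + 1) := by
    intro l _
    rw [Nat.choose_succ_succ', Nat.cast_add, pow_succ]
    ring
  rw [Finset.sum_range_succ' _ (m + 1), Finset.sum_congr rfl h', Finset.sum_sub_distrib]
  simp only [mul_sub, Finset.sum_sub_distrib, ← h, Nat.choose_zero_right]
  ring

/-! ### Assembly -/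

theorem ClassPB.summable_norm_seriesTerm_prod {m : ℕ} {f : ℝ → ℂ} (hf : ClassPB m f) {b : ℝ}
    (hb : Real.log b ≠ 0) {a K : ℕ} (ha : 0 < a) :
    Summable fun p : ↥(Finset.Icc 1 (K - 1)) × ℕ => ‖seriesTerm f b m a K p.1 (p.2 + 1)‖ := by
  rw [summable_prod_of_nonneg fun _ => norm_nonneg _]
  refine ⟨fun k => ?_, (hasSum_fintype _).summable⟩
  have h := hf.summable_norm_seriesTerm hb ha (K := K) (k := (k : ℕ)) k.2
  exact h

theorem mainTheorem5 (L M N : ℕ) (hL : 1 < L) (hM : 1 < M) (hN : 1 < N) (hMN : M ≠ N)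
    (f : ℝ → ℂ) (hf : ClassPB (L - 1) f) :
    (∀ l ∈ Finset.range L,
      Summable (fun p : ↥(Finset.Icc 1 (M - 1)) × ℕ =>
        ‖seriesTerm f ((M : ℝ) / N) (L - 1) (M ^ l * N ^ (L - 1 - l)) M p.1 (p.2 + 1)‖) ∧
      Summable (fun p : ↥(Finset.Icc 1 (N - 1)) × ℕ =>
        ‖seriesTerm f ((M : ℝ) / N) (L - 1) (M ^ l * N ^ (L - 1 - l)) N p.1 (p.2 + 1)‖)) ∧
    ((L - 1).factorial : ℂ) * ((Real.log ((M : ℝ) / N) : ℝ) : ℂ) ^ L * (∫ t in (0 : ℝ)..1, f t) =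
      ∑ l ∈ Finset.range L,
        ((L - 1).choose l : ℂ) * (-(M : ℂ)) ^ l * (N : ℂ) ^ (L - 1 - l) *
          ((∑ k ∈ Finset.Icc 1 (M - 1), ∑' n : ℕ,
              seriesTerm f ((M : ℝ) / N) (L - 1) (M ^ l * N ^ (L - 1 - l)) M k (n + 1)) -
            ∑ k ∈ Finset.Icc 1 (N - 1), ∑' n : ℕ,
              seriesTerm f ((M : ℝ) / N) (L - 1) (M ^ l * N ^ (L - 1 - l)) N k (n + 1)) := by
  obtain ⟨m, rfl⟩ := Nat.exists_eq_succ_of_ne_zero (zero_lt_one.trans hL).ne'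
  simp only [Nat.succ_eq_add_one, Nat.add_sub_cancel] at hf ⊢
  have hM0 : (0 : ℝ) < M := by exact_mod_cast zero_lt_one.trans hM
  have hN0 : (0 : ℝ) < N := by exact_mod_cast zero_lt_one.trans hN
  set b : ℝ := (M : ℝ) / N with hb_def
  have hb0 : 0 < b := div_pos hM0 hN0
  have hb : Real.log b ≠ 0 := by
    refine Real.log_ne_zero_of_pos_of_ne_one hb0 fun h => hMN ?_
    rw [hb_def, div_eq_one_iff_eq hN0.ne'] at h
    exact_mod_cast h
  have hapos : ∀ l, 0 < M ^ l * N ^ (m - l) := fun l => by positivity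
  refine ⟨fun l _ => ⟨hf.summable_norm_seriesTerm_prod hb (hapos l),
    hf.summable_norm_seriesTerm_prod hb (hapos l)⟩, ?_⟩
  -- Putting `0 < a` inside the existential makes `Γ` a total function of the scale, so that
  -- constants at equal scales coincide.
  have hlim : ∀ a : ℝ, ∃ γ : ℂ, 0 < a → Tendsto (fun X : ℕ => (a : ℂ) * ∑ n ∈ Finset.range X,
      weighted f b m (a * ((n : ℝ) + 1)) - weightedPrimitive f b m (a * X)) atTop (𝓝 γ) := by
    intro a
    by_cases ha : 0 < a
    · obtain ⟨γ, hγ⟩ := hf.exists_tendsto_sum_sub_primitive hb ha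
      exact ⟨γ, fun _ => hγ⟩
    · exact ⟨0, fun h => absurd h ha⟩
  choose Γ hΓ using hlim
  have hA : (0 : ℝ) < (N : ℝ) ^ (m + 1) := by positivity
  have hα : ∀ l : ℕ, 0 < (N : ℝ) ^ (m + 1) * b ^ l := fun l => by positivity
  have hmain := sum_choose_mul_limit hf.continuous hf.1 m hb0 hb hA
    (γ := fun l => Γ ((N : ℝ) ^ (m + 1) * b ^ l)) fun l => hΓ _ (hα l)
  rw [← hmain, ← sum_choose_mul_sub_succ m]
  refine Finset.sum_congr rfl fun l hl => ?_
  have hlm : l ≤ m := by rw [Finset.mem_range] at hl; omega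
  have haN : ((M ^ l * N ^ (m - l) : ℕ) : ℝ) * N = (N : ℝ) ^ (m + 1) * b ^ l := by
    obtain ⟨j, rfl⟩ := Nat.exists_eq_add_of_le hlm
    rw [Nat.add_sub_cancel_left, hb_def, div_pow, mul_div_assoc', eq_div_iff (by positivity)]
    push_cast
    ring
  have haM : ((M ^ l * N ^ (m - l) : ℕ) : ℝ) * M = (N : ℝ) ^ (m + 1) * b ^ (l + 1) := by
    rw [pow_succ b, ← mul_assoc, ← haN, mul_assoc, hb_def, mul_div_cancel₀ _ hN0.ne']
  have ha0 : (0 : ℝ) < ((M ^ l * N ^ (m - l) : ℕ) : ℝ) := by exact_mod_cast hapos l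
  have hS := hf.mul_sum_tsum_seriesTerm hb (hapos l) (zero_lt_one.trans hM) (hΓ _ ha0)
    (hΓ _ (mul_pos ha0 hM0))
  have hT := hf.mul_sum_tsum_seriesTerm hb (hapos l) (zero_lt_one.trans hN) (hΓ _ ha0)
    (hΓ _ (mul_pos ha0 hN0))
  rw [neg_pow (M : ℂ)]
  rw [haM] at hS
  rw [haN] at hT
  push_cast at hS hT
  linear_combination (-1 : ℂ) ^ l * m.choose l * (hT - hS)
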